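/- For points $z_1,\dots,z_n\in\mathbb C$ let $\Delta(z_1,\dots,z_n)=\prod_{1\le i<j\le n}|z_i-z_j|^2$, and let \[ \overline\Delta_{\max}(n)=\frac{1}{n^n}\sup\bigl\{\Delta(z_1,\dots,z_n): |z_i-z_j|\le 2\text{ for all } i,j\bigr\}. \] A maximizer is a configuration $(z_1,\dots,z_n)$ with $|z_i-z_j|\le 2$ for all $i,j$ at which $\Delta$ attains its maximum over all such configurations. Then \[ \overline\Delta_{\max}(4)=16(7-4\sqrt3). \] Moreover, up to congruence (translation and rotation) and relabeling of the points, the unique maximizer for $n=4$ is the kite with vertex set $\{0,\,2,\,\sqrt3+i,\,\sqrt3-i\}$: a configuration $(z_1,z_2,z_3,z_4)$ is a maximizer if and only if it is obtained from the vertices of this kite by a translation, a rotation and a relabeling. -/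

import Mathlib

noncomputable section

/-- The discriminant product `∏_{i < j} |z i - z j| ^ 2` of `n` (labelled) points of the plane. -/
def discProd {n : ℕ} (z : Fin n → ℂ) : ℝ :=
  ∏ i : Fin n, ∏ j ∈ Finset.Ioi i, ‖z i - z j‖ ^ 2

/-- The configurations of `n` points all of whose mutual distances are at most `2`. -/
def diamFeasible (n : ℕ) : Set (Fin n → ℂ) :=
  {z | ∀ i j, ‖z i - z j‖ ≤ 2}

/-- The supremum of the discriminant product under the diameter constraint. -/
def discMax (n : ℕ) : ℝ :=
  sSup (discProd '' diamFeasible n)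

/-- The normalized maximal value: the supremum divided by `n ^ n`. -/
def normDiscMax (n : ℕ) : ℝ :=
  discMax n / (n : ℝ) ^ n

/-- A maximizer: a feasible configuration that maximizes the discriminant product among all
feasible configurations. -/
def IsDiscMaximizer {n : ℕ} (z : Fin n → ℂ) : Prop :=
  z ∈ diamFeasible n ∧ IsMaxOn discProd (diamFeasible n) z

/-- Two configurations are congruent by a translation and a rotation, up to a relabeling of the
points. -/
def CongruentUpToRelabeling {n : ℕ} (z w : Fin n → ℂ) : Prop :=
  ∃ (σ : Equiv.Perm (Fin n)) (a c : ℂ), ‖c‖ = 1 ∧ ∀ i, z (σ i) = c * w i + a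

/-- The kite with vertices `0`, `2`, `√3 + i`, `√3 - i`. -/
def kite : Fin 4 → ℂ :=
  ![0, 2, (Real.sqrt 3 : ℂ) + Complex.I, (Real.sqrt 3 : ℂ) - Complex.I]

end

/-! A maximizer exists by compactness. Join two of its points when their distance is 2. This graph
is connected: if no edge left `S`, small translations of `S` would stay feasible, and the product is
the squared modulus of a polynomial in the translation, so the maximum principle would make it
constant, although it vanishes when two points collide (`IsDiscMaximizer.exists_norm_sub_eq`). Hence
four points contain a spanning star or path. For a star, the outer points lie on a circle and
`circle_product_aux` forces the kite. For a path, either an extra edge produces a star, or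
`path_product_lt` makes the product smaller than that of the kite. -/

/-! ### Real inequalities for paths and stars -/

/-- The value bound for a path of three unit segments, in terms of the cosine `S` and sine `T` of
half the sum of the two angles and of the cosine `S + x` of half their difference. -/
theorem path_product_lt_aux {S T x : ℝ} (hT : 0 ≤ T) (hS : 1 / 2 < S) (hST : T ^ 2 + S ^ 2 = 1)
    (hD : 1 / 2 * S + √3 / 2 * T < S + x) (h : 1 - 4 * S * x ≤ 1) :
    4 * x ^ 2 * (1 - 4 * S * x) < 7 - 4 * √3 := by
  have hx : 0 ≤ x := by
    by_contra! hx
    have : S * x < 0 := mul_neg_of_pos_of_neg (by linarith) hx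
    linarith
  have h3 : √3 ^ 2 = 3 := Real.sq_sqrt (by norm_num)
  have h30 : 0 < √3 := by positivity
  generalize √3 = c at *
  have hc : c < 1.73206 := by nlinarith
  have hc' : 1.73205 < c := by nlinarith
  -- For large `S` the maximum over `x`, at `S * x = 1/6`, is small enough; otherwise `x` lies
  -- beyond that point. Any threshold between about 0.7183 and 0.728 serves both cases.
  rcases le_or_gt 0.72 S with hS' | hS'
  · have key : 27 * S ^ 2 * (4 * x ^ 2 * (1 - 4 * S * x)) ≤ 1 := by
      have : 1 - 27 * S ^ 2 * (4 * x ^ 2 * (1 - 4 * S * x)) =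
          (1 - 6 * (S * x)) ^ 2 * (1 + 12 * (S * x)) := by ring
      have : 0 ≤ (1 - 6 * (S * x)) ^ 2 * (1 + 12 * (S * x)) := by positivity
      linarith
    by_contra! hcon
    have h1 : 27 * 0.72 ^ 2 ≤ 27 * S ^ 2 := by gcongr
    have h2 : 27 * 0.72 ^ 2 * (7 - 4 * c) ≤ 27 * S ^ 2 * (4 * x ^ 2 * (1 - 4 * S * x)) :=
      mul_le_mul h1 hcon (by linarith) (by positivity)
    linarith
  -- `y` is the lower bound for `x` given by `hD`. By `h6` it is past the critical point `1 / (6 *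
  -- S)`, so the expression decreases from `y` to `x`.
  · obtain ⟨y, hy⟩ : ∃ y, y = (c * T - S) / 2 := ⟨_, rfl⟩
    have hyx : y < x := by rw [hy]; linarith
    have hcST : 0 ≤ c * S * T := by positivity
    have h6 : 1 ≤ 6 * S * y := by
      have : 1 + 3 * S ^ 2 ≤ 3 * (c * S * T) := by
        apply le_of_sq_le_sq _ (by positivity)
        have e : (3 * (c * S * T)) ^ 2 = 27 * S ^ 2 * (1 - S ^ 2) := by
          rw [← hST]; linear_combination 9 * S ^ 2 * T ^ 2 * h3
        rw [e]
        have h1 : 0.25 ≤ S ^ 2 := by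
          have := pow_le_pow_left₀ (by norm_num) hS.le 2
          linarith
        have h2 : S ^ 2 ≤ 0.5184 := by
          have := pow_le_pow_left₀ (by linarith) hS'.le 2
          linarith
        linarith [mul_nonneg (sub_nonneg.2 h1) (sub_nonneg.2 h2)]
      rw [hy]; linarith
    have hy0 : 0 < y := by
      by_contra! hcon
      have := mul_nonpos_of_nonneg_of_nonpos (show 0 ≤ 6 * S by linarith) hcon
      linarith
    have hdec : 4 * x ^ 2 * (1 - 4 * S * x) < 4 * y ^ 2 * (1 - 4 * S * y) := by
      have h4 : x + y ≤ 6 * S * y * (x + y) := by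
        exact le_mul_of_one_le_left (by linarith) h6
      have h5 : 6 * S * y * (x + y) < 4 * S * (x ^ 2 + x * y + y ^ 2) := by
        have : 0 < 4 * S * ((x - y) * (x + y / 2)) := by
          have : 0 < x - y := by linarith
          positivity
        linarith
      have : 0 < (x - y) * (4 * S * (x ^ 2 + x * y + y ^ 2) - (x + y)) :=
        mul_pos (by linarith) (by linarith)
      linarith
    refine hdec.trans_le ?_
    have e : 4 * y ^ 2 * (1 - 4 * S * y) = ((c * T - S) * (c * S - T)) ^ 2 := by
      have : 1 - 4 * S * y = (c * S - T) ^ 2 := by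
        rw [hy]; linear_combination -S ^ 2 * h3 - hST
      rw [this, hy]; ring
    have e' : (c * T - S) * (c * S - T) = 4 * (S * T) - c := by
      linear_combination S * T * h3 - c * hST
    have e'' : (2 - c) ^ 2 = 7 - 4 * c := by linear_combination h3
    rw [e, ← e'']
    apply pow_le_pow_left₀
    · apply mul_nonneg (by linarith)
      have h1 : T ≤ c * S := by
        apply le_of_sq_le_sq _ (by positivity)
        have := pow_le_pow_left₀ (by norm_num) hS.le 2
        rw [mul_pow, h3]
        linarith
      linarith
    · rw [e']; linarith [sq_nonneg (S - T)]

/-- The value bound for the trigonometric expression attached to a path of three unit segments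
whose end points are at distance less than one from the opposite inner vertices. -/
theorem path_product_lt {α β : ℝ} (hα : |α| ≤ Real.pi) (hβ : |β| ≤ Real.pi)
    (hα' : 1 / 2 < Real.cos α) (hβ' : 1 / 2 < Real.cos β)
    (h : 3 + 2 * Real.cos (α + β) - 2 * Real.cos α - 2 * Real.cos β ≤ 1) :
    (2 - 2 * Real.cos α) * (2 - 2 * Real.cos β) *
      (3 + 2 * Real.cos (α + β) - 2 * Real.cos α - 2 * Real.cos β) < 7 - 4 * √3 := by
  have angle_lt : ∀ {γ : ℝ}, |γ| ≤ Real.pi → 1 / 2 < Real.cos γ → |γ| < Real.pi / 3 := by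
    intro γ hγ hc
    by_contra! hcon
    have := Real.cos_le_cos_of_nonneg_of_le_pi (by positivity) hγ hcon
    rw [Real.cos_pi_div_three, Real.cos_abs] at this
    linarith
  have ha := abs_lt.1 (angle_lt hα hα')
  have hb := abs_lt.1 (angle_lt hβ hβ')
  obtain ⟨s, hs⟩ : ∃ s, s = |α + β| / 2 := ⟨_, rfl⟩
  obtain ⟨d, hd⟩ : ∃ d, d = |α - β| / 2 := ⟨_, rfl⟩
  have hs0 : 0 ≤ s := by rw [hs]; positivity
  have hd0 : 0 ≤ d := by rw [hd]; positivity
  -- `s + d` is the larger of `|α|` and `|β|`.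
  have hsd : s + d < Real.pi / 3 := by
    rw [hs, hd]
    rcases abs_cases (α + β) with h1 | h1 <;> rcases abs_cases (α - β) with h2 | h2 <;> linarith
  have hcs : Real.cos s = Real.cos ((α + β) / 2) := by
    rw [hs, ← Real.cos_abs ((α + β) / 2), abs_div, abs_two]
  have hcd : Real.cos d = Real.cos ((α - β) / 2) := by
    rw [hd, ← Real.cos_abs ((α - β) / 2), abs_div, abs_two]
  have hsum : Real.cos α + Real.cos β = 2 * Real.cos s * Real.cos d := by
    rw [hcs, hcd, Real.cos_add_cos]
  have hdbl : Real.cos (α + β) = 2 * Real.cos s ^ 2 - 1 := by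
    rw [hcs, ← Real.cos_two_mul]; congr 1; ring
  have hdbl' : Real.cos (α - β) = 2 * Real.cos d ^ 2 - 1 := by
    rw [hcd, ← Real.cos_two_mul]; congr 1; ring
  have hprod : Real.cos α * Real.cos β = Real.cos s ^ 2 + Real.cos d ^ 2 - 1 := by
    have h1 := Real.cos_add α β
    have h2 := Real.cos_sub α β
    linarith
  have hD : Real.cos (Real.pi / 3 - s) < Real.cos d :=
    Real.cos_lt_cos_of_nonneg_of_le_pi hd0 (by linarith [Real.pi_pos]) (by linarith)
  rw [Real.cos_sub, Real.cos_pi_div_three, Real.sin_pi_div_three] at hD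
  have hS : 1 / 2 < Real.cos s := by
    rw [← Real.cos_pi_div_three]
    exact Real.cos_lt_cos_of_nonneg_of_le_pi hs0 (by linarith [Real.pi_pos]) (by linarith)
  have hT : 0 ≤ Real.sin s :=
    Real.sin_nonneg_of_nonneg_of_le_pi hs0 (by linarith [Real.pi_pos])
  have hST := Real.sin_sq_add_cos_sq s
  have e1 : (2 - 2 * Real.cos α) * (2 - 2 * Real.cos β) = 4 * (Real.cos d - Real.cos s) ^ 2 := by
    linear_combination 4 * hprod - 4 * hsum
  have e2 : 3 + 2 * Real.cos (α + β) - 2 * Real.cos α - 2 * Real.cos β =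
      1 - 4 * Real.cos s * (Real.cos d - Real.cos s) := by
    linear_combination 2 * hdbl - 2 * hsum
  rw [e2] at h
  rw [e1, e2]
  exact path_product_lt_aux hT hS hST (by linarith) h

/-- Three points of a unit circle, `x`, `y`, `z` being their squared distances, all at most one:
if `z` is the largest, then `x * y * z ≤ (2 - √3) ^ 2`, with equality only in the symmetric case. -/
theorem circle_product_aux {x y z : ℝ} (hx : 0 < x) (hy : 0 < y) (hz : z ≤ 1)
    (hxz : x ≤ z) (hyz : y ≤ z) (hrel : (x + y - z) ^ 2 = x * y * (4 - z))
    (hge : 7 - 4 * √3 ≤ x * y * z) : x = 2 - √3 ∧ y = 2 - √3 ∧ z = 1 := by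
  have h3 : √3 ^ 2 = 3 := Real.sq_sqrt (by norm_num)
  have h30 : 0 < √3 := by positivity
  obtain ⟨p, hp, hpx⟩ : ∃ p, 0 < p ∧ p ^ 2 = x := ⟨√x, by positivity, Real.sq_sqrt hx.le⟩
  obtain ⟨q, hq, hqy⟩ : ∃ q, 0 < q ∧ q ^ 2 = y := ⟨√y, by positivity, Real.sq_sqrt hy.le⟩
  obtain ⟨r, hr, hrz⟩ : ∃ r, 0 ≤ r ∧ r ^ 2 = 4 - z :=
    ⟨√(4 - z), by positivity, Real.sq_sqrt (by linarith)⟩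
  have hcr : √3 ≤ r := by
    apply le_of_sq_le_sq _ hr
    rw [h3, hrz]; linarith
  generalize √3 = c at *
  have hc : c < 1.7321 := by nlinarith
  have hc' : 1.732 < c := by nlinarith
  have hpq : 0 < p * q := by positivity
  have hrel' : (z - x - y - p * q * r) * (z - x - y + p * q * r) = 0 := by
    rw [← hrz, ← hpx, ← hqy] at hrel
    rw [← hpx, ← hqy]
    linear_combination hrel
  have h1 : z - x - y = p * q * r := by
    rcases mul_eq_zero.1 hrel' with h | h
    · linarith
    -- This sign gives `p * q < p * q * r = x + y - z ≤ min x y ≤ p * q`.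
    · exfalso
      have : p * q < p * q * r := lt_mul_of_one_lt_right hpq (by linarith)
      rcases le_total p q with h' | h'
      · have := mul_le_mul_of_nonneg_left h' hp.le
        linarith
      · have := mul_le_mul_of_nonneg_right h' hq.le
        linarith
  -- Here `4 - r ^ 2 = z = p ^ 2 + q ^ 2 + p * q * r`, and `p ^ 2 + q ^ 2 ≥ 2 * p * q`.
  have ht : p * q * (2 + r) ≤ (2 - r) * (2 + r) := by linarith [sq_nonneg (p - q)]
  have ht' : p * q ≤ 2 - r := le_of_mul_le_mul_right ht (by linarith)
  have e : x * y * z = (p * q) ^ 2 * z := by rw [← hpx, ← hqy]; ring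
  have e' : 7 - 4 * c = (2 - c) ^ 2 := by linear_combination -h3
  have h2 : (p * q) ^ 2 ≤ (2 - c) ^ 2 := by
    apply pow_le_pow_left₀ hpq.le; linarith
  have hz1 : z = 1 := by
    apply le_antisymm hz
    rw [e, e'] at hge
    have h5 : 0 < (2 - c) ^ 2 := by apply pow_pos; linarith
    by_contra! hcon
    have h6 : (p * q) ^ 2 * z < (p * q) ^ 2 := mul_lt_of_lt_one_right (by positivity) hcon
    linarith
  have hpq' : p * q = 2 - c := by
    apply le_antisymm (by linarith)
    apply le_of_sq_le_sq _ hpq.le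
    rw [e, e', hz1] at hge
    linarith
  have hrc : r = c := by linarith
  have hpq2 : (p - q) ^ 2 = 0 := by
    rw [hz1, hrc, hpq', ← hpx, ← hqy] at h1
    linear_combination -h1 + h3 - 2 * hpq'
  have hpe : p = q := by
    have := pow_eq_zero_iff (two_ne_zero) |>.1 hpq2
    linarith
  subst hpe
  exact ⟨by rw [← hpx, ← hpq']; ring, by rw [← hqy, ← hpq']; ring, hz1⟩

/-! ### Symmetries of the discriminant product -/

theorem discProd_eq_norm_prod {n : ℕ} (z : Fin n → ℂ) :
    discProd z = ‖∏ i : Fin n, ∏ j ∈ Finset.Ioi i, (z i - z j)‖ ^ 2 := by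
  simp only [discProd, norm_prod, Finset.prod_pow]

/-- As a determinant, the product visibly ignores relabeling (up to a sign inside the norm) and
vanishes when two points coincide. -/
theorem discProd_eq_norm_det {n : ℕ} (z : Fin n → ℂ) :
    discProd z = ‖(Matrix.vandermonde z).det‖ ^ 2 := by
  simp only [discProd, Matrix.det_vandermonde, norm_prod, Finset.prod_pow, norm_sub_rev]

theorem discProd_comp_perm {n : ℕ} (z : Fin n → ℂ) (σ : Equiv.Perm (Fin n)) :
    discProd (z ∘ σ) = discProd z := by
  have h : Matrix.vandermonde (z ∘ σ) = (Matrix.vandermonde z).submatrix σ id := rfl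
  rw [discProd_eq_norm_det, discProd_eq_norm_det, h, Matrix.det_permute, norm_mul]
  rcases Int.units_eq_one_or (Equiv.Perm.sign σ) with h | h <;> simp [h]

theorem discProd_eq_zero {n : ℕ} {z : Fin n → ℂ} {i j : Fin n} (hij : i ≠ j) (h : z i = z j) :
    discProd z = 0 := by
  rw [discProd_eq_norm_det, Matrix.det_zero_of_row_eq hij]
  · simp
  · ext k; simp [Matrix.vandermonde, h]

theorem continuous_discProd {n : ℕ} : Continuous (discProd (n := n)) := by
  unfold discProd
  fun_prop

theorem discProd_four (z : Fin 4 → ℂ) :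
    discProd z = ‖z 0 - z 1‖ ^ 2 * ‖z 0 - z 2‖ ^ 2 * ‖z 0 - z 3‖ ^ 2 *
      (‖z 1 - z 2‖ ^ 2 * ‖z 1 - z 3‖ ^ 2) * ‖z 2 - z 3‖ ^ 2 := by
  have h0 : Finset.Ioi (0 : Fin 4) = {1, 2, 3} := rfl
  have h1 : Finset.Ioi (1 : Fin 4) = {2, 3} := rfl
  have h2 : Finset.Ioi (2 : Fin 4) = {3} := rfl
  have h3 : Finset.Ioi (3 : Fin 4) = ∅ := rfl
  simp [discProd, Fin.prod_univ_four, h0, h1, h2, h3, mul_assoc]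

theorem discProd_mul_add {n : ℕ} {c : ℂ} (hc : ‖c‖ = 1) (a : ℂ) (w : Fin n → ℂ) :
    discProd (fun i => c * w i + a) = discProd w := by
  simp only [discProd, add_sub_add_right_eq_sub, ← mul_sub, norm_mul, hc, one_mul]

theorem CongruentUpToRelabeling.discProd_eq {n : ℕ} {z w : Fin n → ℂ}
    (h : CongruentUpToRelabeling z w) : discProd z = discProd w := by
  obtain ⟨σ, a, c, hc, h⟩ := h
  rw [← discProd_comp_perm z σ, ← discProd_mul_add hc a w]
  exact congrArg _ (funext h)

theorem CongruentUpToRelabeling.mem_diamFeasible {n : ℕ} {z w : Fin n → ℂ}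
    (h : CongruentUpToRelabeling z w) (hw : w ∈ diamFeasible n) : z ∈ diamFeasible n := by
  obtain ⟨σ, a, c, hc, h⟩ := h
  intro i j
  obtain ⟨i, rfl⟩ := σ.surjective i
  obtain ⟨j, rfl⟩ := σ.surjective j
  rw [h, h, add_sub_add_right_eq_sub, ← mul_sub, norm_mul, hc, one_mul]
  exact hw i j

theorem CongruentUpToRelabeling.of_comp_perm {n : ℕ} {z w : Fin n → ℂ} {σ : Equiv.Perm (Fin n)}
    (h : CongruentUpToRelabeling (z ∘ σ) w) : CongruentUpToRelabeling z w := by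
  obtain ⟨τ, a, c, hc, h⟩ := h
  exact ⟨τ.trans σ, a, c, hc, h⟩

theorem IsDiscMaximizer.comp_perm {n : ℕ} {z : Fin n → ℂ} (h : IsDiscMaximizer z)
    (σ : Equiv.Perm (Fin n)) : IsDiscMaximizer (z ∘ σ) := by
  refine ⟨fun i j => h.1 _ _, fun w hw => ?_⟩
  simpa only [Set.mem_ofPred_eq, discProd_comp_perm] using h.2 hw

/-! ### Existence of maximizers and their diameter graph -/

/-- Some configuration of finitely many points attains the maximum. -/
theorem exists_isDiscMaximizer (n : ℕ) : ∃ z : Fin (n + 1) → ℂ, IsDiscMaximizer z := by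
  -- Translation invariance allows pinning one point at the origin, which makes the feasible set
  -- bounded.
  have hK : IsCompact (diamFeasible (n + 1) ∩ {z | z 0 = 0}) := by
    refine (isCompact_univ_pi fun _ : Fin (n + 1) =>
      isCompact_closedBall (0 : ℂ) 2).of_isClosed_subset ?_ ?_
    · refine IsClosed.inter ?_ (isClosed_eq (by fun_prop) continuous_const)
      simp only [diamFeasible, Set.ofPred_forall]
      exact isClosed_iInter fun i => isClosed_iInter fun j =>
        isClosed_le (by fun_prop) continuous_const
    · rintro z ⟨hz, hz0 : z 0 = 0⟩ i -
      simpa [hz0] using hz i 0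
  obtain ⟨z, hz, hmax⟩ := hK.exists_isMaxOn ⟨0, by simp [diamFeasible], rfl⟩
    continuous_discProd.continuousOn
  refine ⟨z, hz.1, fun w hw => ?_⟩
  have e : discProd (fun i => 1 * w i + -w 0) = discProd w := discProd_mul_add (by simp) _ _
  rw [Set.mem_ofPred_eq, ← e]
  refine hmax ⟨fun i j => ?_, by simp⟩
  simpa using hw i j

open Topology in
/-- At a maximizer, the graph of the pairs at distance two is connected: otherwise translate the
points of `S` and use the maximum modulus principle. -/
theorem IsDiscMaximizer.exists_norm_sub_eq {n : ℕ} {z : Fin n → ℂ} (h : IsDiscMaximizer z)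
    (hz : discProd z ≠ 0) {S : Set (Fin n)} {i₀ j₀ : Fin n} (hi₀ : i₀ ∈ S) (hj₀ : j₀ ∉ S) :
    ∃ i ∈ S, ∃ j ∉ S, ‖z i - z j‖ = 2 := by
  classical
  by_contra! hcon
  let Z : ℂ → Fin n → ℂ := fun w i => z i + if i ∈ S then w else 0
  let g : ℂ → ℂ := fun w => ∏ i : Fin n, ∏ j ∈ Finset.Ioi i, (Z w i - Z w j)
  have hg : ∀ w, discProd (Z w) = ‖g w‖ ^ 2 := fun w => discProd_eq_norm_prod _
  have hZc : ∀ i, Differentiable ℂ fun w => Z w i := by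
    intro i
    by_cases hi : i ∈ S <;> simp only [Z, hi, if_true, if_false] <;> fun_prop
  have hgd : Differentiable ℂ g :=
    Differentiable.fun_finsetProd fun i _ => Differentiable.fun_finsetProd fun j _ =>
      (hZc i).sub (hZc j)
  have hZ0 : Z 0 = z := by ext i; simp [Z]
  -- Distances within `S` or within its complement do not change; the others are strictly below 2 at
  -- `w = 0`.
  have hfeas : ∀ᶠ w in 𝓝 0, Z w ∈ diamFeasible n := by
    simp only [diamFeasible, Set.mem_ofPred_eq, Filter.eventually_all]
    intro i j
    by_cases hij : (i ∈ S ↔ j ∈ S)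
    · refine Filter.Eventually.of_forall fun w => ?_
      have : Z w i - Z w j = z i - z j := by simp only [Z, hij]; ring
      rw [this]
      exact h.1 i j
    · have hlt : ‖Z 0 i - Z 0 j‖ < 2 := by
        rw [hZ0]
        refine lt_of_le_of_ne (h.1 i j) ?_
        by_cases hi : i ∈ S
        · exact hcon i hi j (by tauto)
        · rw [norm_sub_rev]
          exact hcon j (by tauto) i hi
      have hc : Continuous fun w => ‖Z w i - Z w j‖ :=
        ((hZc i).continuous.sub (hZc j).continuous).norm
      filter_upwards [hc.continuousAt.eventually_lt_const hlt] with w hw using hw.le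
  have hmax : IsLocalMax (norm ∘ g) 0 := by
    filter_upwards [hfeas] with w hw
    have := h.2 hw
    rw [Set.mem_ofPred_eq, hg, ← hZ0, hg] at this
    exact le_of_sq_le_sq this (norm_nonneg _)
  have hconst := Complex.eventually_eq_of_isLocalMax_norm
    (Filter.Eventually.of_forall fun w => hgd w) hmax
  have hglob : g = fun _ => g 0 :=
    AnalyticOnNhd.eq_of_eventuallyEq (fun w _ => hgd.analyticAt w)
      (fun w _ => analyticAt_const) hconst
  apply hz
  -- This translation moves point `i₀` onto point `j₀`.
  have e : discProd (Z (z j₀ - z i₀)) = 0 := by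
    refine discProd_eq_zero (i := i₀) (j := j₀) (fun e => hj₀ (e ▸ hi₀)) ?_
    simp [Z, hi₀, hj₀]
  rw [← hZ0, hg, ← congrFun hglob (z j₀ - z i₀), ← hg, e]

theorem exists_perm_four {i j k l : Fin 4} (hij : i ≠ j) (hik : i ≠ k) (hil : i ≠ l)
    (hjk : j ≠ k) (hjl : j ≠ l) (hkl : k ≠ l) :
    ∃ σ : Equiv.Perm (Fin 4), σ 0 = i ∧ σ 1 = j ∧ σ 2 = k ∧ σ 3 = l := by
  have h : Function.Injective ![i, j, k, l] := by
    intro a b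
    fin_cases a <;> fin_cases b <;>
      simp [*, hij.symm, hik.symm, hil.symm, hjk.symm, hjl.symm, hkl.symm]
  exact ⟨Equiv.ofBijective _ (Finite.injective_iff_bijective.1 h), rfl, rfl, rfl, rfl⟩

/-- Up to relabeling, the graph of the pairs at distance two contains a star or a path. -/
theorem IsDiscMaximizer.exists_star_or_path {z : Fin 4 → ℂ} (h : IsDiscMaximizer z)
    (hz : discProd z ≠ 0) : ∃ σ : Equiv.Perm (Fin 4),
      ‖z (σ 0) - z (σ 1)‖ = 2 ∧ ‖z (σ 0) - z (σ 2)‖ = 2 ∧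
        (‖z (σ 0) - z (σ 3)‖ = 2 ∨ ‖z (σ 1) - z (σ 3)‖ = 2) := by
  obtain ⟨i, rfl, j, hj, hij⟩ := h.exists_norm_sub_eq hz (S := {0}) (i₀ := 0) (j₀ := 1)
    (by simp) (by simp)
  rw [Set.mem_singleton_iff, ← ne_eq] at hj
  obtain ⟨k₀, hk₀, hk₀'⟩ : ∃ k : Fin 4, k ≠ 0 ∧ k ≠ j := by clear hij; revert j; decide
  obtain ⟨a, ha, k, hk, hak⟩ := h.exists_norm_sub_eq hz (S := {0, j}) (i₀ := 0) (j₀ := k₀)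
    (by simp) (by simp [hk₀, hk₀'])
  simp only [Set.mem_insert_iff, Set.mem_singleton_iff, not_or, ← ne_eq] at ha hk
  -- Two edges leaving the growing sets form a path with middle `c`; the third edge attaches at `c`
  -- (star) or at an end (path).
  obtain ⟨c, x, y, hcx, hcy, hxy, hx, hy⟩ : ∃ c x y : Fin 4, c ≠ x ∧ c ≠ y ∧ x ≠ y ∧
      ‖z c - z x‖ = 2 ∧ ‖z c - z y‖ = 2 := by
    rcases ha with rfl | rfl
    · exact ⟨0, j, k, hj.symm, hk.1.symm, hk.2.symm, hij, hak⟩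
    · exact ⟨a, 0, k, hj, hk.2.symm, hk.1.symm, by rwa [norm_sub_rev], hak⟩
  obtain ⟨l₀, h1, h2, h3⟩ : ∃ l : Fin 4, l ≠ c ∧ l ≠ x ∧ l ≠ y := by
    clear hx hy; revert c x y; decide
  obtain ⟨b, hb, l, hl, hbl⟩ := h.exists_norm_sub_eq hz (S := {c, x, y}) (i₀ := c) (j₀ := l₀)
    (by simp) (by simp [h1, h2, h3])
  simp only [Set.mem_insert_iff, Set.mem_singleton_iff, not_or, ← ne_eq] at hb hl
  obtain ⟨hlc, hlx, hly⟩ := hl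
  rcases hb with rfl | rfl | rfl
  · obtain ⟨σ, rfl, rfl, rfl, rfl⟩ := exists_perm_four hcx hcy hlc.symm hxy hlx.symm hly.symm
    exact ⟨σ, hx, hy, .inl hbl⟩
  · obtain ⟨σ, rfl, rfl, rfl, rfl⟩ := exists_perm_four hcx hcy hlc.symm hxy hlx.symm hly.symm
    exact ⟨σ, hx, hy, .inr hbl⟩
  · obtain ⟨σ, rfl, rfl, rfl, rfl⟩ := exists_perm_four hcy hcx hlc.symm hxy.symm hly.symm hlx.symm
    exact ⟨σ, hy, hx, .inr hbl⟩

/-! ### The kite and the star case -/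

theorem norm_sq_eq (z : ℂ) : ‖z‖ ^ 2 = z.re ^ 2 + z.im ^ 2 := by
  rw [Complex.sq_norm, Complex.normSq_apply]; ring

theorem sq_sqrt_three : √3 ^ 2 = 3 := Real.sq_sqrt (by norm_num)

theorem kite_mem_diamFeasible : kite ∈ diamFeasible 4 := by
  have h3 := sq_sqrt_three
  have hc : 1 < √3 := by rw [Real.lt_sqrt] <;> norm_num
  intro i j
  refine le_of_sq_le_sq ?_ zero_le_two
  rw [norm_sq_eq]
  fin_cases i <;> fin_cases j <;> simp [kite] <;> nlinarith

theorem discProd_kite : discProd kite = 4096 * (7 - 4 * √3) := by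
  have h3 := sq_sqrt_three
  have e : (2 - √3) ^ 2 + 1 = 4 * (2 - √3) := by linear_combination h3
  rw [discProd_four]
  simp only [norm_sq_eq]
  simp [kite, h3, e]
  linear_combination 4096 * h3

/-- A star with symmetric arms is the kite. -/
theorem congruent_kite_of_dist {z : Fin 4 → ℂ} (h2 : ‖z 2 - z 0‖ = 2)
    (h1 : ‖z 1 - z 0‖ = 2) (h3 : ‖z 3 - z 0‖ = 2) (h13 : ‖z 1 - z 3‖ = 2)
    (h12 : ‖z 1 - z 2‖ ^ 2 = 4 * (2 - √3)) (h23 : ‖z 2 - z 3‖ ^ 2 = 4 * (2 - √3)) :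
    CongruentUpToRelabeling z kite := by
  have hc := sq_sqrt_three
  have hne : z 2 - z 0 ≠ 0 := by rw [← norm_ne_zero_iff, h2]; norm_num
  obtain ⟨c, hcdef⟩ : ∃ c, c = (z 2 - z 0) / 2 := ⟨_, rfl⟩
  have hc1 : ‖c‖ = 1 := by rw [hcdef, norm_div, h2]; simp
  have hc0 : c ≠ 0 := by rw [← norm_ne_zero_iff, hc1]; norm_num
  obtain ⟨p, hp⟩ : ∃ p, z 1 = c * p + z 0 := ⟨(z 1 - z 0) / c, by field_simp; ring⟩
  obtain ⟨q, hq⟩ : ∃ q, z 3 = c * q + z 0 := ⟨(z 3 - z 0) / c, by field_simp; ring⟩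
  have hz2 : z 2 = c * 2 + z 0 := by rw [hcdef]; ring
  have np : ‖p‖ ^ 2 = 4 := by
    rw [hp, add_sub_cancel_right, norm_mul, hc1, one_mul] at h1
    rw [h1]; norm_num
  have nq : ‖q‖ ^ 2 = 4 := by
    rw [hq, add_sub_cancel_right, norm_mul, hc1, one_mul] at h3
    rw [h3]; norm_num
  have npq : ‖p - q‖ ^ 2 = 4 := by
    rw [hp, hq, add_sub_add_right_eq_sub, ← mul_sub, norm_mul, hc1, one_mul] at h13
    rw [h13]; norm_num
  rw [hp, hz2, add_sub_add_right_eq_sub, ← mul_sub, norm_mul, hc1, one_mul] at h12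
  rw [hq, hz2, add_sub_add_right_eq_sub, ← mul_sub, norm_mul, hc1, one_mul] at h23
  rw [norm_sq_eq] at np nq npq h12 h23
  simp only [Complex.sub_re, Complex.sub_im, Complex.re_ofNat, Complex.im_ofNat] at npq h12 h23
  have rp : p.re = √3 := by linarith
  have rq : q.re = √3 := by linarith
  rw [rp] at np npq
  rw [rq] at nq npq
  have ip : (p.im - 1) * (p.im + 1) = 0 := by linear_combination np - hc
  have iq : q.im = -p.im := by
    have : (p.im + q.im) ^ 2 = 0 := by linear_combination 2 * np + 2 * nq - npq - 4 * hc
    have := pow_eq_zero_iff two_ne_zero |>.1 this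
    linarith
  -- The kite is symmetric about the real axis, so the two signs differ by a relabeling and no
  -- reflection is needed.
  rcases mul_eq_zero.1 ip with h | h
  · have ep : p = √3 + Complex.I := by
      apply Complex.ext <;> simp <;> linarith
    have eq : q = √3 - Complex.I := by
      apply Complex.ext <;> simp <;> linarith
    obtain ⟨σ, e0, e1, e2, e3⟩ := exists_perm_four (i := 0) (j := 2) (k := 1) (l := 3)
      (by decide) (by decide) (by decide) (by decide) (by decide) (by decide)
    refine ⟨σ, z 0, c, hc1, fun i => ?_⟩
    fin_cases i <;> simp [e0, e1, e2, e3, kite, hz2, hp, hq, ep, eq]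
  · have ep : p = √3 - Complex.I := by
      apply Complex.ext <;> simp <;> linarith
    have eq : q = √3 + Complex.I := by
      apply Complex.ext <;> simp <;> linarith
    obtain ⟨σ, e0, e1, e2, e3⟩ := exists_perm_four (i := 0) (j := 2) (k := 3) (l := 1)
      (by decide) (by decide) (by decide) (by decide) (by decide) (by decide)
    refine ⟨σ, z 0, c, hc1, fun i => ?_⟩
    fin_cases i <;> simp [e0, e1, e2, e3, kite, hz2, hp, hq, ep, eq]

/-- The relation between the squared distances of three points of a circle of radius two. -/
theorem sq_dist_relation {u v w : ℂ} (hu : ‖u‖ = 2) (hv : ‖v‖ = 2) (hw : ‖w‖ = 2) :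
    (‖u - v‖ ^ 2 / 4 + ‖v - w‖ ^ 2 / 4 - ‖u - w‖ ^ 2 / 4) ^ 2 =
      ‖u - v‖ ^ 2 / 4 * (‖v - w‖ ^ 2 / 4) * (4 - ‖u - w‖ ^ 2 / 4) := by
  have hu : ‖u‖ ^ 2 = 4 := by rw [hu]; norm_num
  have hv : ‖v‖ ^ 2 = 4 := by rw [hv]; norm_num
  have hw : ‖w‖ ^ 2 = 4 := by rw [hw]; norm_num
  rw [norm_sq_eq] at hu hv hw
  simp only [norm_sq_eq, Complex.sub_re, Complex.sub_im]
  generalize u.re = a, u.im = b, v.re = c, v.im = d, w.re = e, w.im = f at *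
  obtain ⟨p, hp⟩ : ∃ p, p = a * c + b * d := ⟨_, rfl⟩
  obtain ⟨q, hq⟩ : ∃ q, q = c * e + d * f := ⟨_, rfl⟩
  obtain ⟨r, hr⟩ : ∃ r, r = a * e + b * f := ⟨_, rfl⟩
  -- The Gram determinant of three vectors in the plane vanishes.
  have gram : 4 * 4 * 4 + 2 * p * q * r - 4 * q ^ 2 - 4 * r ^ 2 - 4 * p ^ 2 = 0 := by
    have : (a ^ 2 + b ^ 2) * (c ^ 2 + d ^ 2) * (e ^ 2 + f ^ 2) + 2 * p * q * r
        - (a ^ 2 + b ^ 2) * q ^ 2 - (c ^ 2 + d ^ 2) * r ^ 2 - (e ^ 2 + f ^ 2) * p ^ 2 = 0 := by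
      rw [hp, hq, hr]; ring
    rwa [hu, hv, hw] at this
  have e1 : (a - c) ^ 2 + (b - d) ^ 2 = 8 - 2 * p := by rw [hp]; linear_combination hu + hv
  have e2 : (c - e) ^ 2 + (d - f) ^ 2 = 8 - 2 * q := by rw [hq]; linear_combination hv + hw
  have e3 : (a - e) ^ 2 + (b - f) ^ 2 = 8 - 2 * r := by rw [hr]; linear_combination hu + hw
  rw [e1, e2, e3]
  linear_combination -gram / 16

/-- A maximizer that contains a star whose outer arms are the farthest apart is the kite. -/
theorem congruent_kite_of_star_aux {z : Fin 4 → ℂ} (hz : z ∈ diamFeasible 4)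
    (hge : discProd kite ≤ discProd z) (h1 : ‖z 0 - z 1‖ = 2) (h2 : ‖z 0 - z 2‖ = 2)
    (h3 : ‖z 0 - z 3‖ = 2) (hx : ‖z 1 - z 2‖ ≤ ‖z 1 - z 3‖) (hy : ‖z 2 - z 3‖ ≤ ‖z 1 - z 3‖) :
    CongruentUpToRelabeling z kite := by
  rw [norm_sub_rev] at h1 h2 h3
  have hrel := sq_dist_relation h1 h2 h3
  simp only [sub_sub_sub_cancel_right] at hrel
  rw [discProd_kite, discProd_four, norm_sub_rev (z 0), norm_sub_rev (z 0), norm_sub_rev (z 0),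
    h1, h2, h3] at hge
  have h13 := hz 1 3
  have hc : √3 < 1.7321 := by rw [Real.sqrt_lt] <;> norm_num
  have hpos : 0 < ‖z 1 - z 2‖ ^ 2 * ‖z 1 - z 3‖ ^ 2 * ‖z 2 - z 3‖ ^ 2 := by linarith
  have hx0 : 0 < ‖z 1 - z 2‖ := by
    apply lt_of_le_of_ne (norm_nonneg _)
    intro e
    simp [← e] at hpos
  have hy0 : 0 < ‖z 2 - z 3‖ := by
    apply lt_of_le_of_ne (norm_nonneg _)
    intro e
    simp [← e] at hpos
  have hz4 : ‖z 1 - z 3‖ ^ 2 / 4 ≤ 1 := by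
    have := pow_le_pow_left₀ (norm_nonneg _) h13 2
    linarith
  obtain ⟨ex, ey, ez⟩ := circle_product_aux (by positivity) (by positivity) hz4
    (by gcongr) (by gcongr) hrel (by linarith)
  refine congruent_kite_of_dist h2 h1 h3 ?_ (by linarith) (by linarith)
  have : ‖z 1 - z 3‖ ^ 2 = 2 ^ 2 := by linarith
  exact (pow_left_inj₀ (norm_nonneg _) zero_le_two two_ne_zero).1 this

/-- The outer points are relabeled so that the longest of their three distances is the one required
by `congruent_kite_of_star_aux`. -/
theorem congruent_kite_of_star {z : Fin 4 → ℂ} (hz : IsDiscMaximizer z) {i j k l : Fin 4}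
    (hij : i ≠ j) (hik : i ≠ k) (hil : i ≠ l) (hjk : j ≠ k) (hjl : j ≠ l) (hkl : k ≠ l)
    (h1 : ‖z i - z j‖ = 2) (h2 : ‖z i - z k‖ = 2) (h3 : ‖z i - z l‖ = 2) :
    CongruentUpToRelabeling z kite := by
  have key : ∀ {a b c : Fin 4}, i ≠ a → i ≠ b → i ≠ c → a ≠ b → a ≠ c → b ≠ c →
      ‖z i - z a‖ = 2 → ‖z i - z b‖ = 2 → ‖z i - z c‖ = 2 → ‖z a - z b‖ ≤ ‖z a - z c‖ →
      ‖z b - z c‖ ≤ ‖z a - z c‖ → CongruentUpToRelabeling z kite := by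
    intro a b c hia hib hic hab hac hbc ha hb hc hx hy
    obtain ⟨σ, rfl, rfl, rfl, rfl⟩ := exists_perm_four hia hib hic hab hac hbc
    have hm := hz.comp_perm σ
    exact (congruent_kite_of_star_aux hm.1 (hm.2 kite_mem_diamFeasible) ha hb hc hx hy).of_comp_perm
  have r1 := norm_sub_rev (z k) (z j)
  have r2 := norm_sub_rev (z l) (z k)
  rcases le_total ‖z j - z k‖ ‖z j - z l‖ with a | a <;>
    rcases le_total ‖z k - z l‖ ‖z j - z l‖ with b | b <;>
    rcases le_total ‖z j - z k‖ ‖z k - z l‖ with c | c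
  · exact key hij hik hil hjk hjl hkl h1 h2 h3 a b
  · exact key hij hik hil hjk hjl hkl h1 h2 h3 a b
  · exact key hik hij hil hjk.symm hkl hjl h2 h1 h3 (by rwa [r1]) b
  · exact key hij hik hil hjk hjl hkl h1 h2 h3 a (by linarith)
  · exact key hik hij hil hjk.symm hkl hjl h2 h1 h3 (by rwa [r1]) (by linarith)
  · exact key hij hil hik hjl hjk hkl.symm h1 h3 h2 a (by rwa [r2])
  · exact key hik hij hil hjk.symm hkl hjl h2 h1 h3 (by rwa [r1]) b
  · exact key hij hil hik hjl hjk hkl.symm h1 h3 h2 a (by rwa [r2])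

/-! ### The path case -/

theorem cos_arg_of_norm_one {a : ℂ} (ha : ‖a‖ = 1) : Real.cos a.arg = a.re := by
  rw [Complex.cos_arg (by rw [← norm_ne_zero_iff, ha]; norm_num), ha, div_one]

theorem sin_arg_of_norm_one {a : ℂ} (ha : ‖a‖ = 1) : Real.sin a.arg = a.im := by
  rw [Complex.sin_arg, ha, div_one]

/-- A path of three segments of length two whose other distances are smaller has a smaller
discriminant product than the kite. -/
theorem discProd_lt_of_path {z : Fin 4 → ℂ} (hz : z ∈ diamFeasible 4) (h1 : ‖z 0 - z 1‖ = 2)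
    (h2 : ‖z 0 - z 2‖ = 2) (h3 : ‖z 1 - z 3‖ = 2) (h12 : ‖z 1 - z 2‖ ≠ 2)
    (h03 : ‖z 0 - z 3‖ ≠ 2) : discProd z < discProd kite := by
  have hne : z 1 - z 0 ≠ 0 := by rw [← norm_ne_zero_iff, norm_sub_rev, h1]; norm_num
  rw [norm_sub_rev] at h1
  have hlt12 : ‖z 1 - z 2‖ < 2 := lt_of_le_of_ne (hz 1 2) h12
  have hlt03 : ‖z 0 - z 3‖ < 2 := lt_of_le_of_ne (hz 0 3) h03
  have hle23 : ‖z 2 - z 3‖ ≤ 2 := hz 2 3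
  obtain ⟨a, ha⟩ : ∃ a, z 2 - z 0 = (z 1 - z 0) * a := ⟨(z 2 - z 0) / (z 1 - z 0), by field_simp⟩
  obtain ⟨b, hb⟩ : ∃ b, z 1 - z 3 = (z 1 - z 0) * b := ⟨(z 1 - z 3) / (z 1 - z 0), by field_simp⟩
  have na : ‖a‖ = 1 := by
    rw [norm_sub_rev, ha, norm_mul, h1] at h2
    linarith
  have nb : ‖b‖ = 1 := by
    rw [hb, norm_mul, h1] at h3
    linarith
  have na' := norm_sq_eq a
  have nb' := norm_sq_eq b
  rw [na] at na'
  rw [nb] at nb'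
  have e12 : ‖z 1 - z 2‖ ^ 2 = 4 * (2 - 2 * a.re) := by
    have : z 1 - z 2 = (z 1 - z 0) * (1 - a) := by linear_combination -ha
    rw [this, norm_mul, h1, mul_pow, norm_sq_eq]
    simp only [Complex.sub_re, Complex.sub_im, Complex.one_re, Complex.one_im]
    linear_combination -4 * na'
  have e03 : ‖z 0 - z 3‖ ^ 2 = 4 * (2 - 2 * b.re) := by
    have : z 0 - z 3 = (z 1 - z 0) * (b - 1) := by linear_combination hb
    rw [this, norm_mul, h1, mul_pow, norm_sq_eq]
    simp only [Complex.sub_re, Complex.sub_im, Complex.one_re, Complex.one_im]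
    linear_combination -4 * nb'
  have e23 : ‖z 2 - z 3‖ ^ 2 =
      4 * (3 + 2 * (a.re * b.re + a.im * b.im) - 2 * a.re - 2 * b.re) := by
    have : z 2 - z 3 = (z 1 - z 0) * (a + b - 1) := by linear_combination ha + hb
    rw [this, norm_mul, h1, mul_pow, norm_sq_eq]
    simp only [Complex.sub_re, Complex.sub_im, Complex.add_re, Complex.add_im, Complex.one_re,
      Complex.one_im]
    linear_combination -4 * na' - 4 * nb'
  have l12 := pow_lt_pow_left₀ hlt12 (norm_nonneg _) two_ne_zero
  have l03 := pow_lt_pow_left₀ hlt03 (norm_nonneg _) two_ne_zero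
  have l23 := pow_le_pow_left₀ (norm_nonneg _) hle23 2
  have ca := cos_arg_of_norm_one na
  have cb := cos_arg_of_norm_one nb
  have hcos : Real.cos (a.arg + -b.arg) = a.re * b.re + a.im * b.im := by
    rw [Real.cos_add, Real.cos_neg, Real.sin_neg, ca, cb, sin_arg_of_norm_one na,
      sin_arg_of_norm_one nb]
    ring
  -- A distance below 2 is a cosine above 1/2. The sign in `-b.arg` turns `cos (α + β)` into the
  -- inner product of `a` and `b`.
  have key := path_product_lt (α := a.arg) (β := -b.arg) (Complex.abs_arg_le_pi a)
    (by rw [abs_neg]; exact Complex.abs_arg_le_pi b) (by rw [ca]; linarith)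
    (by rw [Real.cos_neg, cb]; linarith) (by rw [hcos, Real.cos_neg, ca, cb]; linarith)
  rw [hcos, Real.cos_neg, ca, cb] at key
  rw [discProd_four, discProd_kite, e12, e03, e23, h2, h3, norm_sub_rev (z 0), h1]
  linarith

/-! ### Conclusion -/

theorem IsDiscMaximizer.congruent_kite {z : Fin 4 → ℂ} (hz : IsDiscMaximizer z) :
    CongruentUpToRelabeling z kite := by
  have hge : discProd kite ≤ discProd z := hz.2 kite_mem_diamFeasible
  have hpos : 0 < discProd kite := by
    rw [discProd_kite]
    have : √3 < 1.75 := by rw [Real.sqrt_lt] <;> norm_num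
    linarith
  obtain ⟨σ, h1, h2, h3⟩ := hz.exists_star_or_path (hpos.trans_le hge).ne'
  have hm := hz.comp_perm σ
  -- A path needs a further edge, which completes a star centred at one of its inner vertices.
  have hlt : ∀ h3 : ‖z (σ 1) - z (σ 3)‖ = 2,
      ‖z (σ 1) - z (σ 2)‖ = 2 ∨ ‖z (σ 0) - z (σ 3)‖ = 2 := by
    intro h3
    by_contra! hcon
    exact absurd (hm.2 kite_mem_diamFeasible)
      (not_le.2 (discProd_lt_of_path hm.1 h1 h2 h3 hcon.1 hcon.2))
  apply CongruentUpToRelabeling.of_comp_perm (σ := σ)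
  have star : ‖z (σ 0) - z (σ 3)‖ = 2 → CongruentUpToRelabeling (z ∘ σ) kite := fun h =>
    congruent_kite_of_star hm (i := 0) (j := 1) (k := 2) (l := 3) (by decide) (by decide)
      (by decide) (by decide) (by decide) (by decide) h1 h2 h
  rcases h3 with h3 | h3
  · exact star h3
  · rcases hlt h3 with h | h
    · exact congruent_kite_of_star hm (i := 1) (j := 0) (k := 2) (l := 3) (by decide) (by decide)
        (by decide) (by decide) (by decide) (by decide) (by rwa [norm_sub_rev] at h1) h h3
    · exact star h

theorem mainTheorem6 :
    normDiscMax 4 = 16 * (7 - 4 * Real.sqrt 3) ∧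
    ∀ z : Fin 4 → ℂ, IsDiscMaximizer z ↔ CongruentUpToRelabeling z kite := by
  obtain ⟨m, hm⟩ := exists_isDiscMaximizer 3
  have hmk := hm.congruent_kite.discProd_eq
  have hmax : ∀ w ∈ diamFeasible 4, discProd w ≤ discProd kite := fun w hw => hmk ▸ hm.2 hw
  refine ⟨?_, fun z => ⟨IsDiscMaximizer.congruent_kite, fun h =>
    ⟨h.mem_diamFeasible kite_mem_diamFeasible, fun w hw => ?_⟩⟩⟩
  · have hgreat : IsGreatest (discProd '' diamFeasible 4) (discProd kite) :=
      ⟨⟨kite, kite_mem_diamFeasible, rfl⟩, by rintro _ ⟨w, hw, rfl⟩; exact hmax w hw⟩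
    rw [normDiscMax, discMax, hgreat.csSup_eq, discProd_kite]
    push_cast
    ring
  · rw [Set.mem_ofPred_eq, h.discProd_eq]
    exact hmax w hw
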